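/- Let $\alpha_1=1$ and $2(k+1)(4k^2+\tfrac54)\,\alpha_{k+1}+(2k-1)\,\alpha_k=0$ for $k\ge 1$, and let $X_0(x)=\tfrac52+\sum_{k\ge1}\alpha_kx^{2k}$ for $x\in\mathbb{R}$. On $D=\{(x,y)\in\mathbb{R}^2: x>0\}$ put $h(x,y)=2X_0-xX_0'+y^2\,X_0'/x+\sqrt5$ (which is positive on $D$) and $$a_1=\tfrac{2y}{xh}\bigl(X_0+\tfrac{\sqrt5}{2}\bigr),\quad b_1=-\tfrac{1}{xh}\bigl(X_0+\tfrac{\sqrt5}{2}+\sqrt5(x^2-y^2)\bigr),\quad c_1=-\tfrac{2}{xh}\bigl(X_0+\tfrac{\sqrt5}{2}\bigr),$$ $$a_2=-\tfrac1h\bigl(2X_0+\sqrt5-(x^2+y^2)\tfrac{X_0'}{x}\bigr),\quad b_2=-\tfrac{2y}{h}\bigl(\tfrac{X_0'}{2x}+\sqrt5\bigr),\quad c_2=\tfrac{2y}{h}\bigl(X_0''-\tfrac{X_0'}{x}\bigr)$$ Let $f^0:D\to\mathbb{R}^4$ be a curvature surface on $D$, that is, suppose that there is an orthonormal frame field $F^0=[\phi,X^0_\alpha,X^0_\beta,\xi]$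 of $\mathbb{R}^4$ on $D$ which solves the structure equation $dF^0=F^0(\Omega_1\,dx+\Omega_2\,dy)$ with $$\Omega_1=\begin{bmatrix}0&a_1&0&0\\-a_1&0&c_1&b_1\\0&-c_1&0&0\\0&-b_1&0&0\end{bmatrix},\qquad \Omega_2=\begin{bmatrix}0&0&a_2&0\\0&0&-c_2&0\\-a_2&c_2&0&b_2\\0&0&-b_2&0\end{bmatrix},$$ and that $df^0=\dfrac{x^2-y^2}{xh}\,X^0_\alpha\,dx+\dfrac{2y}{h}\,X^0_\beta\,dy$ on $D$. Then for every $x>0$ the limits of the $y$-curve $y\mapsto f^0(x,y)$ as $y\to+\infty$ and as $y\to-\infty$ exist in $\mathbb{R}^4$ and coincide: $$\lim_{y\to+\infty}f^0(x,y)=\lim_{y\to-\infty}f^0(x,y).$$ -/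

import Mathlib

open Filter Topology

noncomputable section

namespace CurvatureSurface

/-- The coefficients `a_k`, `k ≥ 1`, of the hypergeometric series: `a_1 = 1` and
`2 (k + 1) (4 k ^ 2 + 5 / 4) a_{k + 1} + (2 k - 1) a_k = 0` for `k ≥ 1`.
(The value at `k = 0` is not used.) -/
def a : ℕ → ℝ
  | 0 => 0
  | 1 => 1
  | k + 2 => -(2 * ((k : ℝ) + 1) - 1) / (2 * ((k : ℝ) + 2) * (4 * ((k : ℝ) + 1) ^ 2 + 5 / 4))
      * a (k + 1)

/-- `X_0(x) = 5 / 2 + ∑_{k ≥ 1} a_k x ^ (2 k)`. -/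
def X₀ (x : ℝ) : ℝ := 5 / 2 + ∑' k : ℕ, a (k + 1) * x ^ (2 * (k + 1))

/-- The first derivative of `X_0`. -/
def X₀' (x : ℝ) : ℝ := deriv X₀ x

/-- The second derivative of `X_0`. -/
def X₀'' (x : ℝ) : ℝ := deriv X₀' x

/-- `h(x, y) = 2 X_0 - x X_0' + y ^ 2 (X_0' / x) + √5`, for `x > 0`. -/
def h (x y : ℝ) : ℝ := 2 * X₀ x - x * X₀' x + y ^ 2 * (X₀' x / x) + √5

def a₁ (x y : ℝ) : ℝ := 2 * y / (x * h x y) * (X₀ x + √5 / 2)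

def b₁ (x y : ℝ) : ℝ := -1 / (x * h x y) * (X₀ x + √5 / 2 + √5 * (x ^ 2 - y ^ 2))

def c₁ (x y : ℝ) : ℝ := -2 / (x * h x y) * (X₀ x + √5 / 2)

def a₂ (x y : ℝ) : ℝ := -1 / h x y * (2 * X₀ x + √5 - (x ^ 2 + y ^ 2) * (X₀' x / x))

def b₂ (x y : ℝ) : ℝ := -2 * y / h x y * (X₀' x / (2 * x) + √5)

def c₂ (x y : ℝ) : ℝ := 2 * y / h x y * (X₀'' x - X₀' x / x)

/-- The `dx`-part of the matrix-valued one-form `Ω = Ω₁ dx + Ω₂ dy`. -/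
def Ω₁ (x y : ℝ) : Matrix (Fin 4) (Fin 4) ℝ :=
  !![0, a₁ x y, 0, 0;
     -a₁ x y, 0, c₁ x y, b₁ x y;
     0, -c₁ x y, 0, 0;
     0, -b₁ x y, 0, 0]

/-- The `dy`-part of the matrix-valued one-form `Ω = Ω₁ dx + Ω₂ dy`. -/
def Ω₂ (x y : ℝ) : Matrix (Fin 4) (Fin 4) ℝ :=
  !![0, 0, a₂ x y, 0;
     0, 0, -c₂ x y, 0;
     -a₂ x y, c₂ x y, 0, b₂ x y;
     0, 0, -b₂ x y, 0]

/-- `F = [φ, X_α, X_β, ξ]` is an orthonormal frame field of `ℝ⁴` on `D = {(x, y) | x > 0}` that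
solves the structure equation `dF = F Ω`; the vectors `F x y 0, …, F x y 3` are the columns
`φ, X_α, X_β, ξ` at the point `(x, y)`. -/
structure IsFrameField (F : ℝ → ℝ → Fin 4 → EuclideanSpace ℝ (Fin 4)) : Prop where
  orthonormal : ∀ x y : ℝ, 0 < x → Orthonormal ℝ (F x y)
  hasDerivAt_fst : ∀ x y : ℝ, 0 < x → ∀ j : Fin 4,
    HasDerivAt (fun t : ℝ => F t y j) (∑ i : Fin 4, Ω₁ x y i j • F x y i) x
  hasDerivAt_snd : ∀ x y : ℝ, 0 < x → ∀ j : Fin 4,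
    HasDerivAt (fun t : ℝ => F x t j) (∑ i : Fin 4, Ω₂ x y i j • F x y i) y

/-- `f` is a curvature surface on `D = {(x, y) | x > 0}`: for some frame field
`F = [φ, X_α, X_β, ξ]` on `D` that solves the structure equation, `f` is an integral surface of
`df = (x ^ 2 - y ^ 2) / (x h(x, y)) X_α dx + 2 y / h(x, y) X_β dy`. The values of `f` and `F`
outside `D` are irrelevant. -/
def IsCurvatureSurface (f : ℝ → ℝ → EuclideanSpace ℝ (Fin 4)) : Prop :=
  ∃ F : ℝ → ℝ → Fin 4 → EuclideanSpace ℝ (Fin 4), IsFrameField F ∧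
    (∀ x y : ℝ, 0 < x →
      HasDerivAt (fun t : ℝ => f t y) (((x ^ 2 - y ^ 2) / (x * h x y)) • F x y 1) x) ∧
    (∀ x y : ℝ, 0 < x →
      HasDerivAt (fun t : ℝ => f x t) ((2 * y / h x y) • F x y 2) y)

end CurvatureSurface

end

namespace CurvatureSurface

noncomputable section

/-! Fix x and write h = A + B y² with B = X₀'/x. Along the y-curve, f_y and φ_y are both multiples
of X_β. With g = 2y/(By² - A) the X_β terms cancel and (f + gφ)_y = g'φ. Since g' is integrable near
infinity, g → 0 and |φ| = 1, the limit at +∞ exists (`exists_tendsto_atTop`).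

The y-derivatives of X_α and ξ are multiples of f_y with factors depending on x alone, so their
increments along the curve are proportional to those of f. Differentiating in x the relation between
X_α and f at y and -y expresses a scalar factor times f(x,y) - f(x,-y) through unit vectors with
coefficients a₁, c₁ → 0 (`factor_smul_sub`). A first integral of the ODE of X₀ gives B > 0 and a
negative limit for the factor, so the difference tends to 0. -/

/-! ### Power series with factorially decaying coefficients -/

/-- The sum of the power series with coefficients `c`. -/
def powSeries (c : ℕ → ℝ) (z : ℝ) : ℝ := ∑' n, c n * z ^ n

/-- The coefficients of the derivative of the power series with coefficients `c`. -/
def derivCoeff (c : ℕ → ℝ) (n : ℕ) : ℝ := (n + 1) * c (n + 1)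

/-- Coefficients that decay at least as fast as those of the exponential series. -/
def ExpBounded (c : ℕ → ℝ) : Prop := ∃ M : ℝ, ∀ n, |c n| ≤ M / n.factorial

theorem ExpBounded.derivCoeff {c : ℕ → ℝ} (hc : ExpBounded c) : ExpBounded (derivCoeff c) := by
  obtain ⟨M, hM⟩ := hc
  refine ⟨M, fun n => ?_⟩
  have h1 : (0 : ℝ) < n + 1 := by positivity
  have h2 := hM (n + 1)
  rw [Nat.factorial_succ, Nat.cast_mul, Nat.cast_succ] at h2
  rw [CurvatureSurface.derivCoeff, abs_mul, abs_of_pos h1]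
  calc (n + 1 : ℝ) * |c (n + 1)| ≤ (n + 1) * (M / ((n + 1) * n.factorial)) := by gcongr
    _ = M / n.factorial := by field_simp

theorem ExpBounded.summable {c : ℕ → ℝ} (hc : ExpBounded c) (z : ℝ) :
    Summable fun n => c n * z ^ n := by
  obtain ⟨M, hM⟩ := hc
  refine Summable.of_norm_bounded ((Real.summable_pow_div_factorial |z|).mul_left M) fun n => ?_
  rw [norm_mul, norm_pow, Real.norm_eq_abs, Real.norm_eq_abs]
  calc |c n| * |z| ^ n ≤ M / n.factorial * |z| ^ n := by gcongr; exact hM n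
    _ = M * (|z| ^ n / n.factorial) := by ring

theorem ExpBounded.hasDerivAt {c : ℕ → ℝ} (hc : ExpBounded c) (z : ℝ) :
    HasDerivAt (powSeries c) (powSeries (CurvatureSurface.derivCoeff c) z) z := by
  have hd := hc.derivCoeff
  obtain ⟨M, hM⟩ := hd
  -- A ball containing z, on which the differentiated terms are dominated uniformly.
  set R := |z| + 1 with hR
  have hsum : Summable fun n : ℕ => |(n : ℝ) * c n| * R ^ (n - 1) := by
    rw [← summable_nat_add_iff 1]
    refine Summable.of_nonneg_of_le (fun n => by positivity) (fun n => ?_)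
      ((Real.summable_pow_div_factorial R).mul_left M)
    have := hM n
    rw [CurvatureSurface.derivCoeff] at this
    push_cast
    calc _ ≤ M / n.factorial * R ^ n := by gcongr
      _ = _ := by ring
  have key := hasDerivAt_tsum_of_isPreconnected (g := fun n w => c n * w ^ n)
    (g' := fun n w => c n * (n * w ^ (n - 1))) (t := Metric.ball 0 R) (y₀ := 0) (y := z)
    hsum Metric.isOpen_ball (convex_ball 0 R).isPreconnected
    (fun n w _ => (hasDerivAt_pow n w).const_mul (c n))
    (fun n w hw => ?_) (Metric.mem_ball_self (by positivity)) (hc.summable 0)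
    (by simp [hR])
  · refine key.congr_deriv ?_
    have hs : Summable fun n : ℕ => c n * (n * z ^ (n - 1)) := by
      rw [← summable_nat_add_iff 1]
      refine (hc.derivCoeff.summable z).congr fun n => ?_
      simp only [CurvatureSurface.derivCoeff, Nat.add_sub_cancel]
      push_cast
      ring
    rw [hs.tsum_eq_zero_add, powSeries]
    simp only [CurvatureSurface.derivCoeff, Nat.add_sub_cancel]
    push_cast
    simp only [zero_mul, mul_zero, zero_add]
    exact tsum_congr fun n => by ring
  · have hw' : |w| ≤ R := by simpa using (Metric.mem_ball.1 hw).le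
    rw [norm_mul, norm_mul, norm_pow, Real.norm_eq_abs, Real.norm_eq_abs, Real.norm_eq_abs]
    calc |c n| * (|(n : ℝ)| * |w| ^ (n - 1)) ≤ |c n| * (|(n : ℝ)| * R ^ (n - 1)) := by gcongr
      _ = |(n : ℝ) * c n| * R ^ (n - 1) := by rw [abs_mul]; ring

theorem ExpBounded.mul_deriv {c : ℕ → ℝ} (hc : ExpBounded c) (z : ℝ) :
    HasSum (fun n : ℕ => (n : ℝ) * c n * z ^ n)
      (z * powSeries (CurvatureSurface.derivCoeff c) z) := by
  rw [hasSum_nat_add_iff' 1 |>.symm]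
  simp only [Finset.range_one, Finset.sum_singleton, Nat.cast_zero, zero_mul, sub_zero]
  refine ((hc.derivCoeff.summable z).hasSum.mul_left z).congr_fun fun n => ?_
  simp only [CurvatureSurface.derivCoeff]
  push_cast
  ring

theorem ExpBounded.sq_mul_deriv_deriv {c : ℕ → ℝ} (hc : ExpBounded c) (z : ℝ) :
    HasSum (fun n : ℕ => (n : ℝ) * (n - 1) * c n * z ^ n)
      (z ^ 2 * powSeries (CurvatureSurface.derivCoeff (CurvatureSurface.derivCoeff c)) z) := by
  rw [hasSum_nat_add_iff' 1 |>.symm]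
  simp only [Finset.range_one, Finset.sum_singleton, Nat.cast_zero, zero_mul, sub_zero]
  rw [sq, mul_assoc]
  refine ((hc.derivCoeff.mul_deriv z).mul_left z).congr_fun fun n => ?_
  simp only [CurvatureSurface.derivCoeff]
  push_cast
  ring

/-! ### The ODE of the series and its first integral -/

theorem a_add_two (k : ℕ) : 2 * ((k : ℝ) + 2) * (4 * ((k : ℝ) + 1) ^ 2 + 5 / 4) * a (k + 2)
    = -(2 * k + 1) * a (k + 1) := by
  rw [a]
  field_simp
  ring

theorem expBounded_a : ExpBounded a := by
  refine ⟨1, fun n => ?_⟩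
  induction n with
  | zero => simp [a]
  | succ n ih =>
    cases n with
    | zero => simp [a]
    | succ k =>
      have h1 : |a (k + 2)| = (2 * k + 1) / (2 * ((k : ℝ) + 2) * (4 * ((k : ℝ) + 1) ^ 2 + 5 / 4))
          * |a (k + 1)| := by
        rw [a, abs_mul, abs_div, abs_neg, abs_of_pos, abs_of_pos]
        · ring
        · positivity
        · linarith [(Nat.cast_nonneg k : (0 : ℝ) ≤ k)]
      have hk : (0 : ℝ) ≤ k := Nat.cast_nonneg k
      have h2 : (2 * k + 1) / (2 * ((k : ℝ) + 2) * (4 * ((k : ℝ) + 1) ^ 2 + 5 / 4))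
          ≤ 1 / ((k : ℝ) + 2) := by
        rw [div_le_div_iff₀ (by positivity) (by positivity)]
        nlinarith [mul_nonneg hk hk, mul_nonneg hk (mul_nonneg hk hk)]
      rw [h1, Nat.factorial_succ, Nat.cast_mul]
      calc _ ≤ 1 / ((k : ℝ) + 2) * (1 / (k + 1).factorial) := by gcongr
        _ = _ := by push_cast; field_simp; ring

/-- `P 0`, `P 1`, … are `∑ a_k z ^ k` and its successive derivatives. -/
def P (j : ℕ) : ℝ → ℝ := powSeries (derivCoeff^[j] a)

theorem expBounded_iterate (j : ℕ) : ExpBounded (derivCoeff^[j] a) := by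
  induction j with
  | zero => exact expBounded_a
  | succ j ih => rw [Function.iterate_succ_apply']; exact ih.derivCoeff

theorem hasDerivAt_P (j : ℕ) (z : ℝ) : HasDerivAt (P j) (P (j + 1) z) z := by
  rw [P, P, Function.iterate_succ_apply']
  exact (expBounded_iterate j).hasDerivAt z

/-- The coefficient of zⁿ is n + 1 times the recursion of `a`. -/
theorem P_ode (z : ℝ) :
    8 * (z ^ 2 * P 4 z + 3 * (z * P 3 z) + P 2 z) + 5 / 2 * P 2 z + 2 * (z * P 2 z) + P 1 z
      = 0 := by
  have h4 := (expBounded_iterate 2).sq_mul_deriv_deriv z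
  have h3 := (expBounded_iterate 2).mul_deriv z
  have h2 := ((expBounded_iterate 2).summable z).hasSum
  have h2' := (expBounded_iterate 1).mul_deriv z
  have h1 := ((expBounded_iterate 1).summable z).hasSum
  have key := ((((h4.add (h3.mul_left 3)).add h2).mul_left 8).add (h2.mul_left (5 / 2))).add
    (h2'.mul_left 2) |>.add h1
  have h0 := key.congr_fun (g := fun _ => (0 : ℝ)) fun n => ?_
  · exact (h0.unique hasSum_zero)
  · have := a_add_two n
    simp only [Function.iterate_succ, Function.iterate_zero, Function.comp, id, derivCoeff]
    push_cast
    linear_combination (-(n + 1 : ℝ) * z ^ n) * this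

theorem P_one_zero : P 1 0 = 1 := by
  rw [P, powSeries, tsum_eq_single 0 fun n hn => by simp [hn]]
  simp [derivCoeff, a]

/-- The derivative of the left side is 4 `P 1` times `P_ode`; the constant 5 is the value at z = 0.
With z = x², B = X₀'/x and u = X₀'' - B it reads 2Bxu' - u² + (x² + 5/4)B² = 5. -/
theorem P_first_integral (z : ℝ) :
    2 * (2 * P 1 z) * (8 * z * (P 2 z + z * P 3 z)) - (4 * z * P 2 z) ^ 2
      + (z + 5 / 4) * (2 * P 1 z) ^ 2 = 5 := by
  set I : ℝ → ℝ := fun z => 2 * (2 * P 1 z) * (8 * z * (P 2 z + z * P 3 z))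
    - (4 * z * P 2 z) ^ 2 + (z + 5 / 4) * (2 * P 1 z) ^ 2 with hI
  have hd : ∀ w, HasDerivAt I 0 w := fun w => by
    have h1 : HasDerivAt (P 1) (P 2 w) w := hasDerivAt_P 1 w
    have h2 : HasDerivAt (P 2) (P 3 w) w := hasDerivAt_P 2 w
    have h3 : HasDerivAt (P 3) (P 4 w) w := hasDerivAt_P 3 w
    have hw := hasDerivAt_id w
    have := ((((h1.const_mul 2).const_mul 2).mul ((hw.const_mul 8).mul (h2.add (hw.mul h3)))).sub
      (((hw.const_mul 4).mul h2).pow 2)).add ((hw.add_const (5 / 4)).mul ((h1.const_mul 2).pow 2))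
    refine this.congr_deriv ?_
    simp only [id, Pi.mul_apply, Pi.add_apply, Pi.pow_apply, Nat.cast_ofNat]
    linear_combination (4 * P 1 w) * P_ode w
  have hc : I z = I 0 := is_const_of_deriv_eq_zero (fun w => (hd w).differentiableAt)
    (fun w => (hd w).deriv) z 0
  change I z = 5
  rw [hc, hI]
  simp only [P_one_zero]
  norm_num

/-- At a zero of `P 1` the first integral would equate minus a square with 5. -/
theorem P_one_pos {z : ℝ} (hz : 0 ≤ z) : 0 < P 1 z := by
  by_contra! hneg
  have hcont : Continuous (P 1) :=
    continuous_iff_continuousAt.2 fun w => (hasDerivAt_P 1 w).continuousAt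
  obtain ⟨w, -, hw⟩ := intermediate_value_Icc' hz hcont.continuousOn
    (show (0 : ℝ) ∈ Set.Icc (P 1 z) (P 1 0) from ⟨hneg, by rw [P_one_zero]; norm_num⟩)
  have := P_first_integral w
  rw [hw] at this
  nlinarith [sq_nonneg (4 * w * P 2 w)]

/-! ### X₀ and its derivatives through the series, and limits in y -/

theorem X₀_eq (x : ℝ) : X₀ x = 5 / 2 + P 0 (x ^ 2) := by
  rw [X₀, P, powSeries, (expBounded_iterate 0).summable (x ^ 2) |>.tsum_eq_zero_add]
  simp [a, pow_mul]

theorem X₀'_eq (x : ℝ) : X₀' x = 2 * x * P 1 (x ^ 2) := by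
  rw [X₀', funext X₀_eq]
  have := ((hasDerivAt_P 0 (x ^ 2)).comp x (hasDerivAt_pow 2 x)).const_add (5 / 2)
  refine this.deriv.trans ?_
  norm_num
  ring

theorem X₀''_eq (x : ℝ) : X₀'' x = 2 * P 1 (x ^ 2) + 4 * x ^ 2 * P 2 (x ^ 2) := by
  rw [X₀'', funext X₀'_eq]
  have := ((hasDerivAt_id x).const_mul 2).mul
    ((hasDerivAt_P 1 (x ^ 2)).comp x (hasDerivAt_pow 2 x))
  refine this.deriv.trans ?_
  simp only [Function.comp, id]
  norm_num
  ring

theorem X₀'_div {x : ℝ} (hx : x ≠ 0) : X₀' x / x = 2 * P 1 (x ^ 2) := by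
  rw [X₀'_eq]; field_simp

end

theorem X₀'_div_pos {x : ℝ} (hx : 0 < x) : 0 < X₀' x / x := by
  rw [X₀'_div hx.ne']
  exact mul_pos two_pos (P_one_pos (sq_nonneg x))

theorem X₀''_sub {x : ℝ} (hx : x ≠ 0) : X₀'' x - X₀' x / x = 4 * x ^ 2 * P 2 (x ^ 2) := by
  rw [X₀'_div hx, X₀''_eq]; ring

theorem hasDerivAt_X₀''_sub {x : ℝ} (hx : x ≠ 0) :
    HasDerivAt (fun t => X₀'' t - X₀' t / t) (8 * x * (P 2 (x ^ 2) + x ^ 2 * P 3 (x ^ 2))) x := by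
  have h2 : HasDerivAt (fun t : ℝ => P 2 (t ^ 2)) _ x :=
    (hasDerivAt_P 2 (x ^ 2)).comp x (hasDerivAt_pow 2 x)
  have key := ((hasDerivAt_pow 2 x).const_mul 4).mul h2
  refine (key.congr_of_eventuallyEq ?_).congr_deriv ?_
  · filter_upwards [isOpen_ne.mem_nhds hx] with t ht using X₀''_sub ht
  · push_cast
    ring

/-- The limit as `y → ±∞` of the factor relating `f x y - f x (-y)` to decaying terms is
negative. -/
theorem limit_factor_neg {x : ℝ} (hx : 0 < x) :
    8 * x * (P 2 (x ^ 2) + x ^ 2 * P 3 (x ^ 2))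
      + (X₀'' x - X₀' x / x) ^ 2 * (-1 / x / (X₀' x / x))
      - √5 / x / (X₀' x / x) * (X₀' x / (2 * x) + √5) < 0 := by
  have hB : X₀' x / (2 * x) = X₀' x / x / 2 := by field_simp
  rw [hB, X₀''_sub hx.ne', X₀'_div hx.ne']
  have hP := P_one_pos (sq_nonneg x)
  have hI := P_first_integral (x ^ 2)
  have h5 : √5 ^ 2 = 5 := Real.sq_sqrt (by norm_num)
  generalize P 1 (x ^ 2) = p at *
  generalize P 2 (x ^ 2) = q at *
  generalize P 3 (x ^ 2) = r at *
  -- The first integral eliminates r and leaves minus a sum of nonnegative terms, one of them 5.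
  have : 8 * x * (q + x ^ 2 * r) + (4 * x ^ 2 * q) ^ 2 * (-1 / x / (2 * p))
      - √5 / x / (2 * p) * (2 * p / 2 + √5)
      = -(5 + (4 * x ^ 2 * q) ^ 2 + (x ^ 2 + 5 / 4) * (2 * p) ^ 2 + 2 * √5 * p)
        / (4 * x * p) := by
    field_simp
    linear_combination 8 * hI - 16 * h5
  rw [this]
  apply div_neg_of_neg_of_pos
  · rw [neg_lt_zero]; positivity
  · positivity

theorem tendsto_quadratic_div_h {x : ℝ} (hx : 0 < x) (p q r : ℝ) :
    Tendsto (fun y => (p + q * y + r * y ^ 2) / h x y) atTop (𝓝 (r / (X₀' x / x))) := by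
  have hi : Tendsto (fun y : ℝ => y⁻¹) atTop (𝓝 0) := tendsto_inv_atTop_zero
  have hB := (X₀'_div_pos hx).ne'
  have key : Tendsto (fun y : ℝ => (p * y⁻¹ ^ 2 + q * y⁻¹ + r)
      / ((2 * X₀ x - x * X₀' x + √5) * y⁻¹ ^ 2 + X₀' x / x)) atTop
      (𝓝 ((p * 0 ^ 2 + q * 0 + r) / ((2 * X₀ x - x * X₀' x + √5) * 0 ^ 2 + X₀' x / x))) :=
    ((((hi.pow 2).const_mul p).add (hi.const_mul q)).add_const r).div
      (((hi.pow 2).const_mul _).add_const _) (by simpa using hB)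
  have e : (p * 0 ^ 2 + q * 0 + r) / ((2 * X₀ x - x * X₀' x + √5) * 0 ^ 2 + X₀' x / x)
      = r / (X₀' x / x) := by simp
  rw [e] at key
  refine key.congr' ?_
  filter_upwards [eventually_gt_atTop 0] with y hy
  rw [h, ← mul_div_mul_left _ _ (pow_ne_zero 2 hy.ne')]
  congr 1 <;> field_simp
  ring

/-! ### The y-curves of the surface -/

section Frame

variable {f : ℝ → ℝ → EuclideanSpace ℝ (Fin 4)} {F : ℝ → ℝ → Fin 4 → EuclideanSpace ℝ (Fin 4)}

theorem sub_eq_smul_sub_of_hasDerivAt {E : Type*} [NormedAddCommGroup E] [NormedSpace ℝ E]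
    {u v v' : ℝ → E} {k : ℝ} (hu : ∀ y, HasDerivAt u (k • v' y) y)
    (hv : ∀ y, HasDerivAt v (v' y) y) (y z : ℝ) : u y - u z = k • (v y - v z) := by
  have hd : ∀ w, HasDerivAt (fun w => u w - k • v w) 0 w := fun w =>
    ((hu w).sub ((hv w).const_smul k)).congr_deriv (sub_self _)
  have := is_const_of_deriv_eq_zero (fun w => (hd w).differentiableAt) (fun w => (hd w).deriv) y z
  rw [smul_sub]
  rw [sub_eq_sub_iff_add_eq_add] at this ⊢
  rw [this, add_comm]

theorem IsFrameField.alpha_sub (hF : IsFrameField F) {x : ℝ} (hx : 0 < x)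
    (hf : ∀ y, HasDerivAt (fun t => f x t) ((2 * y / h x y) • F x y 2) y) (y z : ℝ) :
    F x y 1 - F x z 1 = (X₀'' x - X₀' x / x) • (f x y - f x z) := by
  refine sub_eq_smul_sub_of_hasDerivAt (fun w => (hF.hasDerivAt_snd x w hx 1).congr_deriv ?_) hf y z
  simp [Fin.sum_univ_four, Ω₂, c₂, smul_smul, mul_comm]

theorem IsFrameField.xi_sub (hF : IsFrameField F) {x : ℝ} (hx : 0 < x)
    (hf : ∀ y, HasDerivAt (fun t => f x t) ((2 * y / h x y) • F x y 2) y) (y z : ℝ) :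
    F x y 3 - F x z 3 = (-(X₀' x / (2 * x) + √5)) • (f x y - f x z) := by
  refine sub_eq_smul_sub_of_hasDerivAt (fun w => (hF.hasDerivAt_snd x w hx 3).congr_deriv ?_) hf y z
  rw [smul_smul]
  simp only [Fin.sum_univ_four, Ω₂, b₂]
  simp
  congr 1
  ring

theorem IsFrameField.exists_tendsto_atTop (hF : IsFrameField F) {x : ℝ} (hx : 0 < x)
    (hf : ∀ y, HasDerivAt (fun t => f x t) ((2 * y / h x y) • F x y 2) y) :
    ∃ p, Tendsto (fun y => f x y) atTop (𝓝 p) := by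
  obtain ⟨A, hA⟩ : ∃ A, A = 2 * X₀ x - x * X₀' x + √5 := ⟨_, rfl⟩
  obtain ⟨B, hB⟩ : ∃ B, B = X₀' x / x := ⟨_, rfl⟩
  have hBpos : 0 < B := hB ▸ X₀'_div_pos hx
  have hphi : ∀ y, HasDerivAt (fun t => F x t 0) (((A - B * y ^ 2) / h x y) • F x y 2) y := by
    intro y
    refine (hF.hasDerivAt_snd x y hx 0).congr_deriv ?_
    simp only [Fin.sum_univ_four, Ω₂, a₂]
    simp
    rw [← neg_smul]
    congr 1
    rw [hA, hB]
    field_simp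
    ring
  -- As Y ≥ 1, y ≥ Y gives y² ≥ y > |A|/B, which keeps By² - A and By² + A positive.
  set Y := |A| / B + 1 with hY
  have hbig : ∀ y, Y ≤ y → |A| < B * y ^ 2 := by
    intro y hy
    have h0 : 0 ≤ |A| / B := by positivity
    have h1 : |A| / B < y ^ 2 := by nlinarith
    rwa [div_lt_iff₀' hBpos] at h1
  set g : ℝ → ℝ := fun y => 2 * y / (B * y ^ 2 - A) with hg
  set g' : ℝ → ℝ := fun y => -2 * (B * y ^ 2 + A) / (B * y ^ 2 - A) ^ 2 with hg'
  have hne : ∀ y, Y ≤ y → B * y ^ 2 - A ≠ 0 := fun y hy =>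
    (sub_pos.2 ((le_abs_self A).trans_lt (hbig y hy))).ne'
  have hgd : ∀ y, Y ≤ y → HasDerivAt g (g' y) y := by
    intro y hy
    have := ((hasDerivAt_id y).const_mul 2).div
      (((hasDerivAt_pow 2 y).const_mul B).sub_const A) (hne y hy)
    refine this.congr_deriv ?_
    simp only [hg', id]
    congr 1
    push_cast
    ring
  have hg0 : Tendsto g atTop (𝓝 0) := by
    have hi : Tendsto (fun y : ℝ => y⁻¹) atTop (𝓝 0) := tendsto_inv_atTop_zero
    have key : Tendsto (fun y : ℝ => 2 * y⁻¹ / (B - A * y⁻¹ ^ 2)) atTop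
        (𝓝 (2 * 0 / (B - A * 0 ^ 2))) :=
      (hi.const_mul 2).div (((hi.pow 2).const_mul A).const_sub B) (by simpa using hBpos.ne')
    rw [mul_zero, zero_div] at key
    refine key.congr' ?_
    filter_upwards [eventually_gt_atTop 0] with y hy
    rw [hg, ← mul_div_mul_left _ _ (pow_ne_zero 2 hy.ne')]
    congr 1 <;> field_simp
  -- g' has constant sign and g has a limit, so no decay estimate is needed.
  have hint : MeasureTheory.IntegrableOn g' (Set.Ioi Y) :=
    MeasureTheory.integrableOn_Ioi_deriv_of_nonpos' (fun y hy => hgd y hy) (fun y hy => by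
      have h1 := hbig y (le_of_lt hy)
      have h2 := neg_abs_le A
      exact div_nonpos_of_nonpos_of_nonneg (by linarith) (sq_nonneg _)) hg0
  have hcont : Continuous fun y => F x y 0 :=
    continuous_iff_continuousAt.2 fun y => (hphi y).continuousAt
  have hint' : MeasureTheory.IntegrableOn (fun y => g' y • F x y 0) (Set.Ioi Y) := by
    refine MeasureTheory.Integrable.mono hint
      (hint.aestronglyMeasurable.smul hcont.aestronglyMeasurable) (MeasureTheory.ae_of_all _ fun y => ?_)
    rw [norm_smul, (hF.orthonormal x y hx).1 0, mul_one]
  have hlim := MeasureTheory.tendsto_limUnder_of_hasDerivAt_of_integrableOn_Ioi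
    (f := fun y => f x y + g y • F x y 0) (fun y hy => by
      have := (hf y).add ((hgd y (le_of_lt hy)).smul (hphi y))
      refine this.congr_deriv ?_
      rw [smul_smul, ← add_assoc, ← add_smul]
      have hz : 2 * y / h x y + g y * ((A - B * y ^ 2) / h x y) = 0 := by
        have := hne y (le_of_lt hy)
        simp only [hg]
        rw [← neg_sub (B * y ^ 2), neg_div, mul_neg, div_mul_div_comm, mul_comm (2 * y),
          mul_div_mul_left _ _ this, add_neg_cancel]
      rw [hz, zero_smul, zero_add]) hint'
  have hgF : Tendsto (fun y => g y • F x y 0) atTop (𝓝 0) := by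
    refine squeeze_zero_norm (fun y => ?_) (tendsto_zero_iff_norm_tendsto_zero.1 hg0)
    rw [norm_smul, (hF.orthonormal x y hx).1 0, mul_one]
  exact ⟨_, by simpa using hlim.sub hgF⟩

theorem h_neg (x y : ℝ) : h x (-y) = h x y := by
  simp [h]

/-- The x-derivative of `alpha_sub` at z = -y, with the X_α and ξ differences rewritten by
`alpha_sub` and `xi_sub`. Since a₁ is odd in y while b₁ and c₁ are even, φ enters as a sum and X_β
as a difference. -/
theorem IsFrameField.factor_smul_sub (hF : IsFrameField F)
    (hfx : ∀ x y, 0 < x →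
      HasDerivAt (fun t => f t y) (((x ^ 2 - y ^ 2) / (x * h x y)) • F x y 1) x)
    (hfy : ∀ x y, 0 < x → HasDerivAt (fun t => f x t) ((2 * y / h x y) • F x y 2) y)
    {x : ℝ} (hx : 0 < x) (y : ℝ) :
    (8 * x * (P 2 (x ^ 2) + x ^ 2 * P 3 (x ^ 2))
      + (X₀'' x - X₀' x / x) ^ 2 * ((x ^ 2 - y ^ 2) / (x * h x y))
      - b₁ x y * (X₀' x / (2 * x) + √5)) • (f x y - f x (-y))
      = a₁ x y • (F x y 0 + F x (-y) 0) - c₁ x y • (F x y 2 - F x (-y) 2) := by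
  have hL := (hF.hasDerivAt_fst x y hx 1).sub (hF.hasDerivAt_fst x (-y) hx 1)
  have hR := (hasDerivAt_X₀''_sub hx.ne').smul ((hfx x y hx).sub (hfx x (-y) hx))
  have heq := hL.unique (hR.congr_of_eventuallyEq (by
    filter_upwards [lt_mem_nhds hx] with t ht
    exact hF.alpha_sub ht (fun y => hfy t y ht) y (-y)))
  have ha : a₁ x (-y) = -a₁ x y := by simp only [a₁, h_neg]; ring
  have hb : b₁ x (-y) = b₁ x y := by simp only [b₁, h_neg]; ring
  have hc : c₁ x (-y) = c₁ x y := by simp only [c₁, h_neg]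
  have h1 := hF.alpha_sub hx (fun y => hfy x y hx) y (-y)
  have h3 := hF.xi_sub hx (fun y => hfy x y hx) y (-y)
  rw [h_neg, neg_sq, ← smul_sub, h1] at heq
  simp only [Fin.sum_univ_four, Ω₁, ha, hb, hc] at heq
  simp at heq
  rw [sub_eq_iff_eq_add] at h3
  rw [h3] at heq
  linear_combination (norm := module) -heq

theorem IsFrameField.tendsto_sub_reflect (hF : IsFrameField F)
    (hfx : ∀ x y, 0 < x →
      HasDerivAt (fun t => f t y) (((x ^ 2 - y ^ 2) / (x * h x y)) • F x y 1) x)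
    (hfy : ∀ x y, 0 < x → HasDerivAt (fun t => f x t) ((2 * y / h x y) • F x y 2) y)
    {x : ℝ} (hx : 0 < x) : Tendsto (fun y => f x y - f x (-y)) atTop (𝓝 0) := by
  have hxn := hx.ne'
  have t0 : Tendsto (fun y => (x ^ 2 - y ^ 2) / (x * h x y)) atTop
      (𝓝 (-1 / x / (X₀' x / x))) :=
    (tendsto_quadratic_div_h hx x 0 (-1 / x)).congr fun y => by
      rw [← div_div]; congr 1; field_simp; ring
  have ta : Tendsto (fun y => a₁ x y) atTop (𝓝 0) := by
    have := tendsto_quadratic_div_h hx 0 (2 / x * (X₀ x + √5 / 2)) 0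
    rw [zero_div] at this
    refine this.congr fun y => ?_
    rw [a₁, ← div_div]; ring
  have tc : Tendsto (fun y => c₁ x y) atTop (𝓝 0) := by
    have := tendsto_quadratic_div_h hx (-2 / x * (X₀ x + √5 / 2)) 0 0
    rw [zero_div] at this
    refine this.congr fun y => ?_
    rw [c₁, ← div_div]; ring
  have tb : Tendsto (fun y => b₁ x y) atTop (𝓝 (√5 / x / (X₀' x / x))) :=
    (tendsto_quadratic_div_h hx (-1 / x * (X₀ x + √5 / 2 + √5 * x ^ 2)) 0 (√5 / x)).congr
      fun y => by rw [b₁, ← div_div]; ring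
  have tL := (((t0.const_mul ((X₀'' x - X₀' x / x) ^ 2)).const_add
    (8 * x * (P 2 (x ^ 2) + x ^ 2 * P 3 (x ^ 2)))).sub
      (tb.mul_const (X₀' x / (2 * x) + √5)))
  have hneg := (limit_factor_neg hx).ne
  have tR : Tendsto (fun y => a₁ x y • (F x y 0 + F x (-y) 0) - c₁ x y • (F x y 2 - F x (-y) 2))
      atTop (𝓝 0) := by
    have hn : ∀ y j, ‖F x y j‖ = 1 := fun y j => (hF.orthonormal x y hx).1 j
    have hb : Tendsto (fun y => |a₁ x y| * 2 + |c₁ x y| * 2) atTop (𝓝 0) := by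
      simpa using (ta.abs.mul_const 2).add (tc.abs.mul_const 2)
    refine squeeze_zero_norm (fun y => (norm_sub_le _ _).trans ?_) hb
    rw [norm_smul, norm_smul, Real.norm_eq_abs, Real.norm_eq_abs]
    gcongr
    · refine (norm_add_le _ _).trans ?_
      rw [hn, hn]; norm_num
    · refine (norm_sub_le _ _).trans ?_
      rw [hn, hn]; norm_num
  have key := (tL.inv₀ hneg).smul tR
  rw [smul_zero] at key
  refine key.congr' ?_
  filter_upwards [tL.eventually_ne hneg] with y hy
  rw [← hF.factor_smul_sub hfx hfy hx y, inv_smul_smul₀ hy]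

end Frame

end CurvatureSurface

theorem mainTheorem9 (f : ℝ → ℝ → EuclideanSpace ℝ (Fin 4))
    (hf : CurvatureSurface.IsCurvatureSurface f) (x : ℝ) (hx : 0 < x) :
    ∃ p : EuclideanSpace ℝ (Fin 4),
      Tendsto (fun y : ℝ => f x y) atTop (𝓝 p) ∧ Tendsto (fun y : ℝ => f x y) atBot (𝓝 p) := by
  obtain ⟨F, hF, hfx, hfy⟩ := hf
  obtain ⟨p, hp⟩ := hF.exists_tendsto_atTop hx fun y => hfy x y hx
  refine ⟨p, hp, ?_⟩
  have := hp.sub (hF.tendsto_sub_reflect hfx hfy hx)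
  simp only [sub_sub_cancel, sub_zero] at this
  simpa [Function.comp_def] using this.comp tendsto_neg_atBot_atTop
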